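/- Let $L$ be a set of letters. Formulae are built from the letters and a constant $O$ by the binary connectives $\times$ and $+$; $|A|$ denotes the number of occurrences of letters in the formula $A$. Typed terms $f:A\to B$ are built from the atomic terms $$\mathbf 1_A:A\to A,\quad l_A:O\to A,\quad k^1_{A,B}:A\times B\to A,\quad k^2_{A,B}:A\times B\to B,$$ $$l^1_{A,B}:A\to A+B,\quad l^2_{A,B}:B\to A+B,\quad w_A:A\to A\times A,\quad m_A:A+A\to A$$ by composition $g\circ f$ and by the operations $f\times g:A\times C\to B\times D$ and $f+g:A+C\to B+D$ for $f:A\to B$, $g:C\to D$. The free sesquicartesian category $\mathcal S$ generated by $L$ has the formulae as objects, and as arrows $A\to B$ the equivalence classes of terms of type $A\to B$ under the least congruence $=$ that satisfies, for all well-typed instances and $i\in\{1,2\}$: the category equations; $\mathbf 1_A\times\mathbf 1_B=\mathbf 1_{A\times B}$, $(g_1\circ g_2)\times(f_1\circ f_2)=(g_1\times f_1)\circ(g_2\times f_2)$, $k^i\circ(f_1\times f_2)=f_i\circ k^i$, $w_B\circ f=(f\times f)\circ w_A$, $k^i_{A,A}\circ w_A=\mathbf 1_A$, $(k^1_{A,B}\times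 k^2_{A,B})\circ w_{A\times B}=\mathbf 1_{A\times B}$, $k^1_{O,O}=k^2_{O,O}$; $\mathbf 1_A+\mathbf 1_B=\mathbf 1_{A+B}$, $(g_1\circ g_2)+(f_1\circ f_2)=(g_1+f_1)\circ(g_2+f_2)$, $(f_1+f_2)\circ l^i=l^i\circ f_i$, $f\circ m_A=m_B\circ(f+f)$, $m_A\circ l^i_{A,A}=\mathbf 1_A$, $m_{A+B}\circ(l^1_{A,B}+l^2_{A,B})=\mathbf 1_{A+B}$, and $f=l_A$ for every $f:O\to A$. Let $\mathcal G$ be the category whose objects are the finite ordinals $n=\{0,\dots,n-1\}$ and whose arrows $n\to m$ are the binary relations $R\subseteq n\times m$, with composition of relations. The functor $G:\mathcal S\to\mathcal G$ has $G(A)=|A|$ and is given on terms by $$G(\mathbf 1_A)=\{(x,x):x\in|A|\},\quad G(l_A)=\emptyset,\quad G(k^1_{A,B})=G(l^1_{A,B})=\{(x,x):x\in|A|\},$$ $$G(k^2_{A,B})=\{(x+|A|,x):x\in|B|\},\quad G(l^2_{A,B})=\{(x,x+|A|):x\in|B|\},$$ $$G(w_A)=\{(x,x),(x,x+|A|):x\in|A|\},\quad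 G(m_A)=\{(x,x),(x+|A|,x):x\in|A|\},$$ $G(g\circ f)=G(g)\circ G(f)$, and $G(f\times g)=G(f+g)=G(f)\cup\{(x+|A|,y+|B|):(x,y)\in G(g)\}$ for $f:A\to B$ and $g:C\to D$. Theorem (Sesquicartesian Coherence). If $f,g:A\to B$ are terms with $G(f)=G(g)$, then $f=g$ in $\mathcal S$. Hence the functor $G:\mathcal S\to\mathcal G$ is faithful. Moreover, equality in $\mathcal S$ is decidable: there is a computable function $d:\mathbb N\times\mathbb N\to\{\mathrm{true},\mathrm{false}\}$ such that for every numbering $c:L\to\mathbb N$ of the letters and all terms $f,g:A\to B$ of the same type, $d(\ulcorner f\urcorner,\ulcorner g\urcorner)=\mathrm{true}$ if and only if $f=g$ in $\mathcal S$, where $\ulcorner\cdot\urcorner$ is the standard Gödel numbering of terms over $c$ by iterated pairing. -/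

import Mathlib

open CategoryTheory

universe u

set_option linter.unusedSimpArgs false

namespace Sesqui

/-- Formulae built from the letters in `L` with the constant `O` and the binary connectives
`×` and `+` (there is no terminal constant `I`).  They are the objects of the free
sesquicartesian category generated by `L`. -/
inductive Formula (L : Type u) : Type u
  | letter (p : L) : Formula L
  | zero : Formula L
  | prod (A B : Formula L) : Formula L
  | sum (A B : Formula L) : Formula L

variable {L : Type u}

/-- The arrow terms; `Tm A B` is the set of terms of type `A → B`. -/
inductive Tm : Formula L → Formula L → Type u
  /-- the identity `1_A : A → A` -/
  | one (A : Formula L) : Tm A A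
  /-- `l_A : O → A` -/
  | l (A : Formula L) : Tm .zero A
  /-- the first projection `k¹_{A,B} : A × B → A` -/
  | k1 (A B : Formula L) : Tm (.prod A B) A
  /-- the second projection `k²_{A,B} : A × B → B` -/
  | k2 (A B : Formula L) : Tm (.prod A B) B
  /-- the first injection `l¹_{A,B} : A → A + B` -/
  | l1 (A B : Formula L) : Tm A (.sum A B)
  /-- the second injection `l²_{A,B} : B → A + B` -/
  | l2 (A B : Formula L) : Tm B (.sum A B)
  /-- the diagonal `w_A : A → A × A` -/
  | w (A : Formula L) : Tm A (.prod A A)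
  /-- the codiagonal `m_A : A + A → A` -/
  | m (A : Formula L) : Tm (.sum A A) A
  /-- `comp g f` is the composite `g ∘ f` -/
  | comp {A B C : Formula L} (g : Tm B C) (f : Tm A B) : Tm A C
  /-- `f × g` -/
  | prod {A B C D : Formula L} (f : Tm A B) (g : Tm C D) : Tm (.prod A C) (.prod B D)
  /-- `f + g` -/
  | sum {A B C D : Formula L} (f : Tm A B) (g : Tm C D) : Tm (.sum A C) (.sum B D)

/-- Equality of terms in the free sesquicartesian category: the least congruence on terms that
contains the equations below. -/
inductive TmEq : ∀ {A B : Formula L}, Tm A B → Tm A B → Prop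
  -- equivalence relation
  | refl {A B : Formula L} (f : Tm A B) : TmEq f f
  | symm {A B : Formula L} {f g : Tm A B} : TmEq f g → TmEq g f
  | trans {A B : Formula L} {f g h : Tm A B} : TmEq f g → TmEq g h → TmEq f h
  -- congruence
  | comp_congr {A B C : Formula L} {g g' : Tm B C} {f f' : Tm A B} :
      TmEq g g' → TmEq f f' → TmEq (.comp g f) (.comp g' f')
  | prod_congr {A B C D : Formula L} {f f' : Tm A B} {g g' : Tm C D} :
      TmEq f f' → TmEq g g' → TmEq (.prod f g) (.prod f' g')
  | sum_congr {A B C D : Formula L} {f f' : Tm A B} {g g' : Tm C D} :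
      TmEq f f' → TmEq g g' → TmEq (.sum f g) (.sum f' g')
  -- categorial equations
  | one_comp {A B : Formula L} (f : Tm A B) : TmEq (.comp (.one B) f) f
  | comp_one {A B : Formula L} (f : Tm A B) : TmEq (.comp f (.one A)) f
  | assoc {A B C D : Formula L} (h : Tm C D) (g : Tm B C) (f : Tm A B) :
      TmEq (.comp h (.comp g f)) (.comp (.comp h g) f)
  -- nonempty finite products
  | prod_one (A B : Formula L) : TmEq (.prod (.one A) (.one B)) (.one (.prod A B))
  | prod_comp {A B C A' B' C' : Formula L}
      (g₁ : Tm B C) (g₂ : Tm A B) (f₁ : Tm B' C') (f₂ : Tm A' B') :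
      TmEq (.prod (.comp g₁ g₂) (.comp f₁ f₂)) (.comp (.prod g₁ f₁) (.prod g₂ f₂))
  | k1_nat {A₁ A₂ B₁ B₂ : Formula L} (f₁ : Tm A₁ B₁) (f₂ : Tm A₂ B₂) :
      TmEq (.comp (.k1 B₁ B₂) (.prod f₁ f₂)) (.comp f₁ (.k1 A₁ A₂))
  | k2_nat {A₁ A₂ B₁ B₂ : Formula L} (f₁ : Tm A₁ B₁) (f₂ : Tm A₂ B₂) :
      TmEq (.comp (.k2 B₁ B₂) (.prod f₁ f₂)) (.comp f₂ (.k2 A₁ A₂))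
  | w_nat {A B : Formula L} (f : Tm A B) :
      TmEq (.comp (.w B) f) (.comp (.prod f f) (.w A))
  | k1_w (A : Formula L) : TmEq (.comp (.k1 A A) (.w A)) (.one A)
  | k2_w (A : Formula L) : TmEq (.comp (.k2 A A) (.w A)) (.one A)
  | k_w (A B : Formula L) :
      TmEq (.comp (.prod (.k1 A B) (.k2 A B)) (.w (.prod A B))) (.one (.prod A B))
  -- the two projections from `O × O` are equal
  | kO : TmEq (.k1 .zero .zero) (.k2 .zero .zero)
  -- finite sums
  | sum_one (A B : Formula L) : TmEq (.sum (.one A) (.one B)) (.one (.sum A B))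
  | sum_comp {A B C A' B' C' : Formula L}
      (g₁ : Tm B C) (g₂ : Tm A B) (f₁ : Tm B' C') (f₂ : Tm A' B') :
      TmEq (.sum (.comp g₁ g₂) (.comp f₁ f₂)) (.comp (.sum g₁ f₁) (.sum g₂ f₂))
  | l1_nat {A₁ A₂ B₁ B₂ : Formula L} (f₁ : Tm A₁ B₁) (f₂ : Tm A₂ B₂) :
      TmEq (.comp (.sum f₁ f₂) (.l1 A₁ A₂)) (.comp (.l1 B₁ B₂) f₁)
  | l2_nat {A₁ A₂ B₁ B₂ : Formula L} (f₁ : Tm A₁ B₁) (f₂ : Tm A₂ B₂) :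
      TmEq (.comp (.sum f₁ f₂) (.l2 A₁ A₂)) (.comp (.l2 B₁ B₂) f₂)
  | m_nat {A B : Formula L} (f : Tm A B) :
      TmEq (.comp f (.m A)) (.comp (.m B) (.sum f f))
  | m_l1 (A : Formula L) : TmEq (.comp (.m A) (.l1 A A)) (.one A)
  | m_l2 (A : Formula L) : TmEq (.comp (.m A) (.l2 A A)) (.one A)
  | m_l (A B : Formula L) :
      TmEq (.comp (.m (.sum A B)) (.sum (.l1 A B) (.l2 A B))) (.one (.sum A B))
  | l_uniq {A : Formula L} (f : Tm .zero A) : TmEq f (.l A)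

/-- Terms of type `A → B` up to equality in the free sesquicartesian category. -/
def tmSetoid (A B : Formula L) : Setoid (Tm A B) where
  r := TmEq
  iseqv := ⟨TmEq.refl, TmEq.symm, TmEq.trans⟩

/-- The free sesquicartesian category generated by `L`: objects are formulae, arrows are
equivalence classes of terms. -/
instance freeSesqui (L : Type u) : Category.{u} (Formula L) where
  Hom A B := Quotient (tmSetoid A B)
  id A := Quotient.mk _ (Tm.one A)
  comp f g := Quotient.map₂ (fun f g => Tm.comp g f)
    (fun _ _ hf _ _ hg => TmEq.comp_congr hg hf) f g
  id_comp f := Quotient.inductionOn f fun f => Quotient.sound (TmEq.comp_one f)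
  comp_id f := Quotient.inductionOn f fun f => Quotient.sound (TmEq.one_comp f)
  assoc f g h := Quotient.inductionOn₃ f g h fun f g h => Quotient.sound (TmEq.assoc h g f)

/-- The arrow of the free sesquicartesian category named by a term. -/
def Tm.toHom {A B : Formula L} (f : Tm A B) : A ⟶ B :=
  Quotient.mk (tmSetoid A B) f

/-- Objects of the graphical category: the finite ordinals. -/
def Graphical : Type := ℕ

/-- The graphical category: an arrow `n → m` is a binary relation from
`n = {0, …, n-1}` to `m = {0, …, m-1}`; composition is composition of relations. -/
instance graphical : Category.{0} Graphical where
  Hom n m := SetRel (Fin n) (Fin m)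
  id n := SetRel.id (α := Fin n)
  comp {n m k} f g := SetRel.comp (α := Fin n) (β := Fin m) (γ := Fin k) f g
  id_comp f := SetRel.id_comp f
  comp_id f := SetRel.comp_id f
  assoc f g h := SetRel.comp_assoc f g h

/-- `|A|`: the number of occurrences of letters in `A`. -/
def Formula.len : Formula L → ℕ
  | .letter _ => 1
  | .zero => 0
  | .prod A B => A.len + B.len
  | .sum A B => A.len + B.len

/-- For `R ⊆ a × b` and `S ⊆ c × d`, the relation
`R ∪ {(x + a, y + b) : (x, y) ∈ S} ⊆ (a + c) × (b + d)`. -/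
def juxtapose {a b c d : ℕ} (R : SetRel (Fin a) (Fin b)) (S : SetRel (Fin c) (Fin d)) :
    SetRel (Fin (a + c)) (Fin (b + d)) :=
  {q | (∃ x y, (x, y) ∈ R ∧ q = (Fin.castAdd c x, Fin.castAdd d y)) ∨
    (∃ x y, (x, y) ∈ S ∧ q = (Fin.natAdd a x, Fin.natAdd b y))}

/-- `{(x, x) : x < a} ⊆ (a + b) × a`, the relation of a first projection. -/
def relK1 (a b : ℕ) : SetRel (Fin (a + b)) (Fin a) := {q | q.1 = Fin.castAdd b q.2}

/-- `{(x + a, x) : x < b} ⊆ (a + b) × b`, the relation of a second projection. -/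
def relK2 (a b : ℕ) : SetRel (Fin (a + b)) (Fin b) := {q | q.1 = Fin.natAdd a q.2}

/-- `{(x, x) : x < a} ⊆ a × (a + b)`, the relation of a first injection. -/
def relL1 (a b : ℕ) : SetRel (Fin a) (Fin (a + b)) := {q | q.2 = Fin.castAdd b q.1}

/-- `{(x, x + a) : x < b} ⊆ b × (a + b)`, the relation of a second injection. -/
def relL2 (a b : ℕ) : SetRel (Fin b) (Fin (a + b)) := {q | q.2 = Fin.natAdd a q.1}

/-- `{(x, x) : x < a} ∪ {(x, x + a) : x < a} ⊆ a × (a + a)`, the relation of a diagonal. -/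
def relW (a : ℕ) : SetRel (Fin a) (Fin (a + a)) :=
  {q | q.2 = Fin.castAdd a q.1 ∨ q.2 = Fin.natAdd a q.1}

/-- `{(x, x) : x < a} ∪ {(x + a, x) : x < a} ⊆ (a + a) × a`, the relation of a codiagonal. -/
def relM (a : ℕ) : SetRel (Fin (a + a)) (Fin a) :=
  {q | q.1 = Fin.castAdd a q.2 ∨ q.1 = Fin.natAdd a q.2}

/-- The relation `G(f) ⊆ |A| × |B|` of a term `f : A → B`. -/
def Tm.graph : ∀ {A B : Formula L}, Tm A B → SetRel (Fin A.len) (Fin B.len)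
  | _, _, .one _ => SetRel.id
  | _, _, .l _ => ∅
  | _, _, .k1 A B => relK1 A.len B.len
  | _, _, .k2 A B => relK2 A.len B.len
  | _, _, .l1 A B => relL1 A.len B.len
  | _, _, .l2 A B => relL2 A.len B.len
  | _, _, .w A => relW A.len
  | _, _, .m A => relM A.len
  | _, _, .comp g f => SetRel.comp f.graph g.graph
  | _, _, .prod f g => juxtapose f.graph g.graph
  | _, _, .sum f g => juxtapose f.graph g.graph

theorem juxtapose_cc {a b c d : ℕ} (R : SetRel (Fin a) (Fin b)) (S : SetRel (Fin c) (Fin d))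
    (x : Fin a) (y : Fin b) :
    (Fin.castAdd c x, Fin.castAdd d y) ∈ juxtapose R S ↔ (x, y) ∈ R := by
  simp [juxtapose, Fin.ext_iff]
  constructor
  · rintro (⟨x', y', h, h1, h2⟩ | ⟨x', y', h, h1, h2⟩)
    · rwa [Fin.ext h1, Fin.ext h2]
    · omega
  · intro h
    exact Or.inl ⟨x, y, h, rfl, rfl⟩

theorem juxtapose_nn {a b c d : ℕ} (R : SetRel (Fin a) (Fin b)) (S : SetRel (Fin c) (Fin d))
    (x : Fin c) (y : Fin d) :
    (Fin.natAdd a x, Fin.natAdd b y) ∈ juxtapose R S ↔ (x, y) ∈ S := by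
  simp [juxtapose, Fin.ext_iff]
  constructor
  · rintro (⟨x', y', h, h1, h2⟩ | ⟨x', y', h, h1, h2⟩)
    · omega
    · rwa [Fin.ext h1, Fin.ext h2]
  · intro h
    exact Or.inr ⟨x, y, h, rfl, rfl⟩

theorem juxtapose_cn {a b c d : ℕ} (R : SetRel (Fin a) (Fin b)) (S : SetRel (Fin c) (Fin d))
    (x : Fin a) (y : Fin d) :
    (Fin.castAdd c x, Fin.natAdd b y) ∉ juxtapose R S := by
  simp [juxtapose, Fin.ext_iff]
  constructor <;> intros <;> omega

theorem juxtapose_nc {a b c d : ℕ} (R : SetRel (Fin a) (Fin b)) (S : SetRel (Fin c) (Fin d))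
    (x : Fin c) (y : Fin b) :
    (Fin.natAdd a x, Fin.castAdd d y) ∉ juxtapose R S := by
  simp [juxtapose, Fin.ext_iff]
  constructor <;> intros <;> omega

theorem castAdd_ne_natAdd {a b : ℕ} (x : Fin a) (y : Fin b) :
    Fin.castAdd b x ≠ Fin.natAdd a y := by
  simp [Fin.ext_iff]
  omega

theorem natAdd_ne_castAdd {a b : ℕ} (x : Fin a) (y : Fin b) :
    Fin.natAdd a y ≠ Fin.castAdd b x := (castAdd_ne_natAdd x y).symm

theorem exists_fin_add {a b : ℕ} {P : Fin (a + b) → Prop} :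
    (∃ x, P x) ↔ (∃ x, P (Fin.castAdd b x)) ∨ ∃ x, P (Fin.natAdd a x) := by
  constructor
  · rintro ⟨x, hx⟩
    induction x using Fin.addCases with
    | left x => exact Or.inl ⟨x, hx⟩
    | right x => exact Or.inr ⟨x, hx⟩
  · rintro (⟨x, hx⟩ | ⟨x, hx⟩) <;> exact ⟨_, hx⟩

theorem forall_fin_add {a b : ℕ} {P : Fin (a + b) → Prop} :
    (∀ x, P x) ↔ (∀ x, P (Fin.castAdd b x)) ∧ ∀ x, P (Fin.natAdd a x) :=
  ⟨fun h => ⟨fun _ => h _, fun _ => h _⟩, fun h x => Fin.addCases h.1 h.2 x⟩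

theorem setRel_ext_iff {α β : Type} {R S : SetRel α β} :
    R = S ↔ ∀ a b, (a, b) ∈ R ↔ (a, b) ∈ S := by
  constructor
  · rintro rfl a b
    rfl
  · intro h
    ext ⟨a, b⟩
    exact h a b

theorem mem_relK1 {a b : ℕ} {x : Fin (a + b)} {y : Fin a} :
    (x, y) ∈ relK1 a b ↔ x = Fin.castAdd b y := Iff.rfl

theorem mem_relK2 {a b : ℕ} {x : Fin (a + b)} {y : Fin b} :
    (x, y) ∈ relK2 a b ↔ x = Fin.natAdd a y := Iff.rfl

theorem mem_relL1 {a b : ℕ} {x : Fin a} {y : Fin (a + b)} :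
    (x, y) ∈ relL1 a b ↔ y = Fin.castAdd b x := Iff.rfl

theorem mem_relL2 {a b : ℕ} {x : Fin b} {y : Fin (a + b)} :
    (x, y) ∈ relL2 a b ↔ y = Fin.natAdd a x := Iff.rfl

theorem mem_relW {a : ℕ} {x : Fin a} {y : Fin (a + a)} :
    (x, y) ∈ relW a ↔ y = Fin.castAdd a x ∨ y = Fin.natAdd a x := Iff.rfl

theorem mem_relM {a : ℕ} {x : Fin (a + a)} {y : Fin a} :
    (x, y) ∈ relM a ↔ x = Fin.castAdd a y ∨ x = Fin.natAdd a y := Iff.rfl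

theorem juxtapose_id (a b : ℕ) :
    juxtapose (SetRel.id (α := Fin a)) (SetRel.id (α := Fin b)) = SetRel.id := by
  simp only [setRel_ext_iff, forall_fin_add, exists_fin_add, SetRel.mem_comp, SetRel.mem_id,
    juxtapose_cc, juxtapose_cn, juxtapose_nc, juxtapose_nn, mem_relK1, mem_relK2, mem_relL1,
    mem_relL2, mem_relW, mem_relM, Fin.castAdd_inj, Fin.natAdd_inj, castAdd_ne_natAdd,
    natAdd_ne_castAdd]
  grind

theorem juxtapose_comp {a b c a' b' c' : ℕ} (R : SetRel (Fin a) (Fin b)) (S : SetRel (Fin b) (Fin c))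
    (R' : SetRel (Fin a') (Fin b')) (S' : SetRel (Fin b') (Fin c')) :
    juxtapose (R.comp S) (R'.comp S') = (juxtapose R R').comp (juxtapose S S') := by
  simp only [setRel_ext_iff, forall_fin_add, exists_fin_add, SetRel.mem_comp, SetRel.mem_id,
    juxtapose_cc, juxtapose_cn, juxtapose_nc, juxtapose_nn, mem_relK1, mem_relK2, mem_relL1,
    mem_relL2, mem_relW, mem_relM, Fin.castAdd_inj, Fin.natAdd_inj, castAdd_ne_natAdd,
    natAdd_ne_castAdd]
  grind

theorem juxtapose_relK1 {a b c d : ℕ} (R : SetRel (Fin a) (Fin b)) (S : SetRel (Fin c) (Fin d)) :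
    (juxtapose R S).comp (relK1 b d) = (relK1 a c).comp R := by
  simp only [setRel_ext_iff, forall_fin_add, exists_fin_add, SetRel.mem_comp, SetRel.mem_id,
    juxtapose_cc, juxtapose_cn, juxtapose_nc, juxtapose_nn, mem_relK1, mem_relK2, mem_relL1,
    mem_relL2, mem_relW, mem_relM, Fin.castAdd_inj, Fin.natAdd_inj, castAdd_ne_natAdd,
    natAdd_ne_castAdd]
  grind

theorem juxtapose_relK2 {a b c d : ℕ} (R : SetRel (Fin a) (Fin b)) (S : SetRel (Fin c) (Fin d)) :
    (juxtapose R S).comp (relK2 b d) = (relK2 a c).comp S := by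
  simp only [setRel_ext_iff, forall_fin_add, exists_fin_add, SetRel.mem_comp, SetRel.mem_id,
    juxtapose_cc, juxtapose_cn, juxtapose_nc, juxtapose_nn, mem_relK1, mem_relK2, mem_relL1,
    mem_relL2, mem_relW, mem_relM, Fin.castAdd_inj, Fin.natAdd_inj, castAdd_ne_natAdd,
    natAdd_ne_castAdd]
  grind

theorem comp_relW {a b : ℕ} (R : SetRel (Fin a) (Fin b)) :
    R.comp (relW b) = (relW a).comp (juxtapose R R) := by
  simp only [setRel_ext_iff, forall_fin_add, exists_fin_add, SetRel.mem_comp, SetRel.mem_id,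
    juxtapose_cc, juxtapose_cn, juxtapose_nc, juxtapose_nn, mem_relK1, mem_relK2, mem_relL1,
    mem_relL2, mem_relW, mem_relM, Fin.castAdd_inj, Fin.natAdd_inj, castAdd_ne_natAdd,
    natAdd_ne_castAdd]
  grind

theorem relW_relK1 (a : ℕ) :
    (relW a).comp (relK1 a a) = SetRel.id := by
  simp only [setRel_ext_iff, forall_fin_add, exists_fin_add, SetRel.mem_comp, SetRel.mem_id,
    juxtapose_cc, juxtapose_cn, juxtapose_nc, juxtapose_nn, mem_relK1, mem_relK2, mem_relL1,
    mem_relL2, mem_relW, mem_relM, Fin.castAdd_inj, Fin.natAdd_inj, castAdd_ne_natAdd,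
    natAdd_ne_castAdd]
  grind

theorem relW_relK2 (a : ℕ) :
    (relW a).comp (relK2 a a) = SetRel.id := by
  simp only [setRel_ext_iff, forall_fin_add, exists_fin_add, SetRel.mem_comp, SetRel.mem_id,
    juxtapose_cc, juxtapose_cn, juxtapose_nc, juxtapose_nn, mem_relK1, mem_relK2, mem_relL1,
    mem_relL2, mem_relW, mem_relM, Fin.castAdd_inj, Fin.natAdd_inj, castAdd_ne_natAdd,
    natAdd_ne_castAdd]
  grind

theorem relW_juxtapose (a b : ℕ) :
    (relW (a + b)).comp (juxtapose (relK1 a b) (relK2 a b)) = SetRel.id := by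
  simp only [setRel_ext_iff, forall_fin_add, exists_fin_add, SetRel.mem_comp, SetRel.mem_id,
    juxtapose_cc, juxtapose_cn, juxtapose_nc, juxtapose_nn, mem_relK1, mem_relK2, mem_relL1,
    mem_relL2, mem_relW, mem_relM, Fin.castAdd_inj, Fin.natAdd_inj, castAdd_ne_natAdd,
    natAdd_ne_castAdd]
  simp [eq_comm]

theorem relL1_juxtapose {a b c d : ℕ} (R : SetRel (Fin a) (Fin b)) (S : SetRel (Fin c) (Fin d)) :
    (relL1 a c).comp (juxtapose R S) = R.comp (relL1 b d) := by
  simp only [setRel_ext_iff, forall_fin_add, exists_fin_add, SetRel.mem_comp, SetRel.mem_id,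
    juxtapose_cc, juxtapose_cn, juxtapose_nc, juxtapose_nn, mem_relK1, mem_relK2, mem_relL1,
    mem_relL2, mem_relW, mem_relM, Fin.castAdd_inj, Fin.natAdd_inj, castAdd_ne_natAdd,
    natAdd_ne_castAdd]
  grind

theorem relL2_juxtapose {a b c d : ℕ} (R : SetRel (Fin a) (Fin b)) (S : SetRel (Fin c) (Fin d)) :
    (relL2 a c).comp (juxtapose R S) = S.comp (relL2 b d) := by
  simp only [setRel_ext_iff, forall_fin_add, exists_fin_add, SetRel.mem_comp, SetRel.mem_id,
    juxtapose_cc, juxtapose_cn, juxtapose_nc, juxtapose_nn, mem_relK1, mem_relK2, mem_relL1,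
    mem_relL2, mem_relW, mem_relM, Fin.castAdd_inj, Fin.natAdd_inj, castAdd_ne_natAdd,
    natAdd_ne_castAdd]
  grind

theorem relM_comp {a b : ℕ} (R : SetRel (Fin a) (Fin b)) :
    (relM a).comp R = (juxtapose R R).comp (relM b) := by
  simp only [setRel_ext_iff, forall_fin_add, exists_fin_add, SetRel.mem_comp, SetRel.mem_id,
    juxtapose_cc, juxtapose_cn, juxtapose_nc, juxtapose_nn, mem_relK1, mem_relK2, mem_relL1,
    mem_relL2, mem_relW, mem_relM, Fin.castAdd_inj, Fin.natAdd_inj, castAdd_ne_natAdd,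
    natAdd_ne_castAdd]
  grind

theorem relL1_relM (a : ℕ) :
    (relL1 a a).comp (relM a) = SetRel.id := by
  simp only [setRel_ext_iff, forall_fin_add, exists_fin_add, SetRel.mem_comp, SetRel.mem_id,
    juxtapose_cc, juxtapose_cn, juxtapose_nc, juxtapose_nn, mem_relK1, mem_relK2, mem_relL1,
    mem_relL2, mem_relW, mem_relM, Fin.castAdd_inj, Fin.natAdd_inj, castAdd_ne_natAdd,
    natAdd_ne_castAdd]
  grind

theorem relL2_relM (a : ℕ) :
    (relL2 a a).comp (relM a) = SetRel.id := by
  simp only [setRel_ext_iff, forall_fin_add, exists_fin_add, SetRel.mem_comp, SetRel.mem_id,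
    juxtapose_cc, juxtapose_cn, juxtapose_nc, juxtapose_nn, mem_relK1, mem_relK2, mem_relL1,
    mem_relL2, mem_relW, mem_relM, Fin.castAdd_inj, Fin.natAdd_inj, castAdd_ne_natAdd,
    natAdd_ne_castAdd]
  grind

theorem juxtapose_relM (a b : ℕ) :
    (juxtapose (relL1 a b) (relL2 a b)).comp (relM (a + b)) = SetRel.id := by
  simp only [setRel_ext_iff, forall_fin_add, exists_fin_add, SetRel.mem_comp, SetRel.mem_id,
    juxtapose_cc, juxtapose_cn, juxtapose_nc, juxtapose_nn, mem_relK1, mem_relK2, mem_relL1,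
    mem_relL2, mem_relW, mem_relM, Fin.castAdd_inj, Fin.natAdd_inj, castAdd_ne_natAdd,
    natAdd_ne_castAdd]
  simp [eq_comm]

/-- `G` respects equality of terms. -/
theorem TmEq.graph_eq {A B : Formula L} {f g : Tm A B} (h : TmEq f g) : f.graph = g.graph := by
  induction h with
  | refl f => rfl
  | symm _ ih => exact ih.symm
  | trans _ _ ih₁ ih₂ => exact ih₁.trans ih₂
  | comp_congr _ _ ih₁ ih₂ => exact congrArg₂ (fun R S => SetRel.comp S R) ih₁ ih₂
  | prod_congr _ _ ih₁ ih₂ => exact congrArg₂ juxtapose ih₁ ih₂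
  | sum_congr _ _ ih₁ ih₂ => exact congrArg₂ juxtapose ih₁ ih₂
  | one_comp f => exact SetRel.comp_id f.graph
  | comp_one f => exact SetRel.id_comp f.graph
  | assoc h g f => exact SetRel.comp_assoc f.graph g.graph h.graph
  | prod_one A B => exact juxtapose_id A.len B.len
  | prod_comp g₁ g₂ f₁ f₂ => exact juxtapose_comp g₂.graph g₁.graph f₂.graph f₁.graph
  | k1_nat f₁ f₂ => exact juxtapose_relK1 f₁.graph f₂.graph
  | k2_nat f₁ f₂ => exact juxtapose_relK2 f₁.graph f₂.graph
  | w_nat f => exact comp_relW f.graph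
  | k1_w A => exact relW_relK1 A.len
  | k2_w A => exact relW_relK2 A.len
  | k_w A B => exact relW_juxtapose A.len B.len
  | kO => exact setRel_ext_iff.2 fun a => Fin.elim0 a
  | sum_one A B => exact juxtapose_id A.len B.len
  | sum_comp g₁ g₂ f₁ f₂ => exact juxtapose_comp g₂.graph g₁.graph f₂.graph f₁.graph
  | l1_nat f₁ f₂ => exact relL1_juxtapose f₁.graph f₂.graph
  | l2_nat f₁ f₂ => exact relL2_juxtapose f₁.graph f₂.graph
  | m_nat f => exact relM_comp f.graph
  | m_l1 A => exact relL1_relM A.len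
  | m_l2 A => exact relL2_relM A.len
  | m_l A B => exact juxtapose_relM A.len B.len
  | l_uniq f => exact setRel_ext_iff.2 fun a => Fin.elim0 a

/-- The functor `G` from the free sesquicartesian category to the graphical category, with
`G(A) = |A|` on objects and `Tm.graph` on arrows. -/
def G (L : Type u) : Formula L ⥤ Graphical where
  obj A := A.len
  map {A B} f := Quotient.lift (s := tmSetoid A B) Tm.graph (fun _ _ h => TmEq.graph_eq h) f
  map_id _ := rfl
  map_comp f g := Quotient.inductionOn₂ f g fun _ _ => rfl

/-- Gödel numbers of formulae, relative to a numbering `c` of the letters. -/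
def Formula.code (c : L → ℕ) : Formula L → ℕ
  | .letter p => Nat.pair 0 (c p)
  | .zero => Nat.pair 1 0
  | .prod A B => Nat.pair 2 (Nat.pair (A.code c) (B.code c))
  | .sum A B => Nat.pair 3 (Nat.pair (A.code c) (B.code c))

/-- Gödel numbers of terms, relative to a numbering `c` of the letters. -/
def Tm.code (c : L → ℕ) : ∀ {A B : Formula L}, Tm A B → ℕ
  | _, _, .one A => Nat.pair 0 (A.code c)
  | _, _, .l A => Nat.pair 1 (A.code c)
  | _, _, .k1 A B => Nat.pair 2 (Nat.pair (A.code c) (B.code c))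
  | _, _, .k2 A B => Nat.pair 3 (Nat.pair (A.code c) (B.code c))
  | _, _, .l1 A B => Nat.pair 4 (Nat.pair (A.code c) (B.code c))
  | _, _, .l2 A B => Nat.pair 5 (Nat.pair (A.code c) (B.code c))
  | _, _, .w A => Nat.pair 6 (A.code c)
  | _, _, .m A => Nat.pair 7 (A.code c)
  | _, _, .comp g f => Nat.pair 8 (Nat.pair (g.code c) (f.code c))
  | _, _, .prod f g => Nat.pair 9 (Nat.pair (f.code c) (g.code c))
  | _, _, .sum f g => Nat.pair 10 (Nat.pair (f.code c) (g.code c))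

end Sesqui

/-! The connectives `×` and `+` are binary product and coproduct, and `O` is initial. Cut
elimination shows that every arrow is denoted by a cut-free derivation, so an arrow can be analysed
by its last rule.

The equation `kO` makes any two parallel arrows into `O` equal (`hom_zero_ext`). By induction on
cut-free derivations, an arrow with empty relation factors through `O` (`exists_factor_zero`). Hence
parallel arrows with empty relations are equal, which settles the cases where a derivation is not
visible in its relation. The same induction shows that an arrow into `B + C` whose relation misses
`C` factors through the first injection, and symmetrically for `B`.

Coherence is then an induction on source and target. A sum as source and a product as target split
by their universal properties, and `O` on either side is trivial. Otherwise the source is a letter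
or a product and the target a letter or a sum. If one arrow factors through an injection, its
relation forces the other to do so too. If both begin with the same projection, it cancels. If they
begin with different projections, both relations are empty.

For decidability, coherence reduces equality of terms to equality of finite relations. A list
enumerating the relation is computed from a Gödel number by primitive recursion, and two such lists
are compared by mutual inclusion. -/

namespace Sesqui

/-! ### Universal properties of products, sums and the initial object -/

section Structure

variable {L : Type u} {A B C D : Formula L}

/-- The first projection, as an arrow. -/
def fst (A B : Formula L) : Formula.prod A B ⟶ A := (Tm.k1 A B).toHom

/-- The second projection, as an arrow. -/
def snd (A B : Formula L) : Formula.prod A B ⟶ B := (Tm.k2 A B).toHom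

/-- The first injection, as an arrow. -/
def inl (A B : Formula L) : A ⟶ Formula.sum A B := (Tm.l1 A B).toHom

/-- The second injection, as an arrow. -/
def inr (A B : Formula L) : B ⟶ Formula.sum A B := (Tm.l2 A B).toHom

/-- The arrow out of the initial object. -/
def init (A : Formula L) : Formula.zero ⟶ A := (Tm.l A).toHom

/-- The pairing `(f × g) ∘ w`. -/
def pair (f : A ⟶ B) (g : A ⟶ C) : A ⟶ Formula.prod B C :=
  Quotient.map₂ (fun f g => Tm.comp (Tm.prod f g) (Tm.w A))
    (fun _ _ hf _ _ hg => TmEq.comp_congr (TmEq.prod_congr hf hg) (TmEq.refl _)) f g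

/-- The copairing `m ∘ (f + g)`. -/
def copair (f : A ⟶ C) (g : B ⟶ C) : Formula.sum A B ⟶ C :=
  Quotient.map₂ (fun f g => Tm.comp (Tm.m C) (Tm.sum f g))
    (fun _ _ hf _ _ hg => TmEq.comp_congr (TmEq.refl _) (TmEq.sum_congr hf hg)) f g

theorem pair_fst (f : A ⟶ B) (g : A ⟶ C) : pair f g ≫ fst B C = f :=
  Quotient.inductionOn₂ f g fun f g => Quotient.sound <|
    (TmEq.assoc _ _ _).trans <| (TmEq.comp_congr (TmEq.k1_nat f g) (.refl _)).trans <|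
      (TmEq.assoc _ _ _).symm.trans <| (TmEq.comp_congr (.refl _) (TmEq.k1_w A)).trans <|
        TmEq.comp_one f

theorem pair_snd (f : A ⟶ B) (g : A ⟶ C) : pair f g ≫ snd B C = g :=
  Quotient.inductionOn₂ f g fun f g => Quotient.sound <|
    (TmEq.assoc _ _ _).trans <| (TmEq.comp_congr (TmEq.k2_nat f g) (.refl _)).trans <|
      (TmEq.assoc _ _ _).symm.trans <| (TmEq.comp_congr (.refl _) (TmEq.k2_w A)).trans <|
        TmEq.comp_one g

/-- Naturality of `w` moves `h` to the front of the composite, and `k_w` collapses what remains to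
the identity. Uniqueness of pairings follows. -/
theorem pair_eta (h : A ⟶ Formula.prod B C) : pair (h ≫ fst B C) (h ≫ snd B C) = h :=
  Quotient.inductionOn h fun h => Quotient.sound <|
    (TmEq.comp_congr (TmEq.prod_comp _ _ _ _) (.refl _)).trans <|
      (TmEq.assoc _ _ _).symm.trans <| (TmEq.comp_congr (.refl _) (TmEq.w_nat h).symm).trans <|
        (TmEq.assoc _ _ _).trans <| (TmEq.comp_congr (TmEq.k_w B C) (.refl _)).trans <|
          TmEq.one_comp h

theorem inl_copair (f : A ⟶ C) (g : B ⟶ C) : inl A B ≫ copair f g = f :=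
  Quotient.inductionOn₂ f g fun f g => Quotient.sound <|
    (TmEq.assoc _ _ _).symm.trans <| (TmEq.comp_congr (.refl _) (TmEq.l1_nat f g)).trans <|
      (TmEq.assoc _ _ _).trans <| (TmEq.comp_congr (TmEq.m_l1 C) (.refl _)).trans <|
        TmEq.one_comp f

theorem inr_copair (f : A ⟶ C) (g : B ⟶ C) : inr A B ≫ copair f g = g :=
  Quotient.inductionOn₂ f g fun f g => Quotient.sound <|
    (TmEq.assoc _ _ _).symm.trans <| (TmEq.comp_congr (.refl _) (TmEq.l2_nat f g)).trans <|
      (TmEq.assoc _ _ _).trans <| (TmEq.comp_congr (TmEq.m_l2 C) (.refl _)).trans <|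
        TmEq.one_comp g

theorem copair_eta (h : Formula.sum A B ⟶ C) : copair (inl A B ≫ h) (inr A B ≫ h) = h :=
  Quotient.inductionOn h fun h => Quotient.sound <|
    (TmEq.comp_congr (.refl _) (TmEq.sum_comp _ _ _ _)).trans <|
      (TmEq.assoc _ _ _).trans <| (TmEq.comp_congr (TmEq.m_nat h).symm (.refl _)).trans <|
        (TmEq.assoc _ _ _).symm.trans <| (TmEq.comp_congr (.refl _) (TmEq.m_l A B)).trans <|
          TmEq.comp_one h

theorem prod_hom_ext {f g : A ⟶ Formula.prod B C} (h₁ : f ≫ fst B C = g ≫ fst B C)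
    (h₂ : f ≫ snd B C = g ≫ snd B C) : f = g := by
  rw [← pair_eta f, h₁, h₂, pair_eta]

theorem sum_hom_ext {f g : Formula.sum A B ⟶ C} (h₁ : inl A B ≫ f = inl A B ≫ g)
    (h₂ : inr A B ≫ f = inr A B ≫ g) : f = g := by
  rw [← copair_eta f, h₁, h₂, copair_eta]

theorem zero_hom_ext (f g : Formula.zero ⟶ A) : f = g :=
  Quotient.inductionOn₂ f g fun f g => Quotient.sound ((TmEq.l_uniq f).trans (TmEq.l_uniq g).symm)

/-- The initial object is subterminal. -/
theorem hom_zero_ext (f g : A ⟶ Formula.zero) : f = g := by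
  -- Both arrows are recovered from `pair f g` by the projections of `O × O`, and these coincide.
  have h : fst .zero .zero = snd (L := L) .zero .zero := Quotient.sound TmEq.kO
  rw [← pair_fst f g, h, pair_snd]

theorem comp_pair (h : D ⟶ A) (f : A ⟶ B) (g : A ⟶ C) :
    h ≫ pair f g = pair (h ≫ f) (h ≫ g) :=
  prod_hom_ext (by rw [Category.assoc, pair_fst, pair_fst])
    (by rw [Category.assoc, pair_snd, pair_snd])

theorem copair_comp (f : A ⟶ C) (g : B ⟶ C) (h : C ⟶ D) :
    copair f g ≫ h = copair (f ≫ h) (g ≫ h) :=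
  sum_hom_ext (by rw [← Category.assoc, inl_copair, inl_copair])
    (by rw [← Category.assoc, inr_copair, inr_copair])

theorem toHom_prod (f : Tm A B) (g : Tm C D) :
    (Tm.prod f g).toHom = pair (fst A C ≫ f.toHom) (snd A C ≫ g.toHom) :=
  prod_hom_ext ((Quotient.sound (TmEq.k1_nat f g)).trans (pair_fst _ _).symm)
    ((Quotient.sound (TmEq.k2_nat f g)).trans (pair_snd _ _).symm)

theorem toHom_sum (f : Tm A B) (g : Tm C D) :
    (Tm.sum f g).toHom = copair (f.toHom ≫ inl B D) (g.toHom ≫ inr B D) :=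
  sum_hom_ext ((Quotient.sound (TmEq.l1_nat f g)).trans (inl_copair _ _).symm)
    ((Quotient.sound (TmEq.l2_nat f g)).trans (inr_copair _ _).symm)

theorem toHom_w (A : Formula L) : (Tm.w A).toHom = pair (𝟙 A) (𝟙 A) :=
  prod_hom_ext ((Quotient.sound (TmEq.k1_w A)).trans (pair_fst _ _).symm)
    ((Quotient.sound (TmEq.k2_w A)).trans (pair_snd _ _).symm)

theorem toHom_m (A : Formula L) : (Tm.m A).toHom = copair (𝟙 A) (𝟙 A) :=
  sum_hom_ext ((Quotient.sound (TmEq.m_l1 A)).trans (inl_copair _ _).symm)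
    ((Quotient.sound (TmEq.m_l2 A)).trans (inr_copair _ _).symm)

end Structure

/-! ### Cut elimination -/

section CutElimination

variable {L : Type u}

/-- Cut-free sequent derivations. -/
inductive CutFree : Formula L → Formula L → Type u
  | ax (p : L) : CutFree (.letter p) (.letter p)
  | init (A : Formula L) : CutFree .zero A
  | fst {A C : Formula L} (B : Formula L) (f : CutFree A C) : CutFree (.prod A B) C
  | snd {B C : Formula L} (A : Formula L) (f : CutFree B C) : CutFree (.prod A B) C
  | inl {A C : Formula L} (B : Formula L) (f : CutFree C A) : CutFree C (.sum A B)
  | inr {B C : Formula L} (A : Formula L) (f : CutFree C B) : CutFree C (.sum A B)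
  | pair {A B C : Formula L} (f : CutFree C A) (g : CutFree C B) : CutFree C (.prod A B)
  | copair {A B C : Formula L} (f : CutFree A C) (g : CutFree B C) : CutFree (.sum A B) C

namespace CutFree

/-- The arrow denoted by a cut-free derivation. -/
def hom : ∀ {A B : Formula L}, CutFree A B → (A ⟶ B)
  | _, _, .ax p => 𝟙 (Formula.letter p)
  | _, _, .init A => Sesqui.init A
  | _, _, .fst B f => Sesqui.fst _ B ≫ f.hom
  | _, _, .snd A f => Sesqui.snd A _ ≫ f.hom
  | _, _, .inl B f => f.hom ≫ Sesqui.inl _ B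
  | _, _, .inr A f => f.hom ≫ Sesqui.inr A _
  | _, _, .pair f g => Sesqui.pair f.hom g.hom
  | _, _, .copair f g => Sesqui.copair f.hom g.hom

/-- Cut elimination: the arrows of cut-free derivations are closed under composition. -/
theorem exists_hom_eq_comp : ∀ {A B C : Formula L} (f : CutFree A B) (g : CutFree B C),
    ∃ h : CutFree A C, h.hom = f.hom ≫ g.hom
  | _, _, _, .ax p, g => ⟨g, (Category.id_comp _).symm⟩
  | _, _, _, .init A, g => ⟨.init _, zero_hom_ext _ _⟩
  | _, _, _, .fst B f, g =>
    let ⟨h, hh⟩ := exists_hom_eq_comp f g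
    ⟨.fst B h, by simp [hom, hh]⟩
  | _, _, _, .snd A f, g =>
    let ⟨h, hh⟩ := exists_hom_eq_comp f g
    ⟨.snd A h, by simp [hom, hh]⟩
  | _, _, _, .copair f₁ f₂, g =>
    let ⟨h₁, hh₁⟩ := exists_hom_eq_comp f₁ g
    let ⟨h₂, hh₂⟩ := exists_hom_eq_comp f₂ g
    ⟨.copair h₁ h₂, by simp [hom, hh₁, hh₂, copair_comp]⟩
  -- The left rules of the first derivation have been permuted out. Now the right rules of the
  -- second are; the principal cuts come last, where an introduction meets its elimination.
  | _, _, _, f, .inl B g =>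
    let ⟨h, hh⟩ := exists_hom_eq_comp f g
    ⟨.inl B h, by simp [hom, hh]⟩
  | _, _, _, f, .inr A g =>
    let ⟨h, hh⟩ := exists_hom_eq_comp f g
    ⟨.inr A h, by simp [hom, hh]⟩
  | _, _, _, f, .pair g₁ g₂ =>
    let ⟨h₁, hh₁⟩ := exists_hom_eq_comp f g₁
    let ⟨h₂, hh₂⟩ := exists_hom_eq_comp f g₂
    ⟨.pair h₁ h₂, by simp [hom, hh₁, hh₂, comp_pair]⟩
  | _, _, _, .inl B f, .copair g₁ g₂ =>
    let ⟨h, hh⟩ := exists_hom_eq_comp f g₁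
    ⟨h, by simp [hom, hh, inl_copair]⟩
  | _, _, _, .inr A f, .copair g₁ g₂ =>
    let ⟨h, hh⟩ := exists_hom_eq_comp f g₂
    ⟨h, by simp [hom, hh, inr_copair]⟩
  | _, _, _, .pair f₁ f₂, .fst _ g =>
    let ⟨h, hh⟩ := exists_hom_eq_comp f₁ g
    ⟨h, by rw [hh]; simp only [hom]; rw [← Category.assoc, pair_fst]⟩
  | _, _, _, .pair f₁ f₂, .snd _ g =>
    let ⟨h, hh⟩ := exists_hom_eq_comp f₂ g
    ⟨h, by rw [hh]; simp only [hom]; rw [← Category.assoc, pair_snd]⟩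
termination_by A B C f g => sizeOf f + sizeOf g

/-- Axioms are restricted to letters, so compound identities are obtained by eta-expansion. -/
theorem exists_hom_eq_id : ∀ A : Formula L, ∃ h : CutFree A A, h.hom = 𝟙 A
  | .letter p => ⟨.ax p, rfl⟩
  | .zero => ⟨.init _, zero_hom_ext _ _⟩
  | .prod A B =>
    let ⟨a, ha⟩ := exists_hom_eq_id A
    let ⟨b, hb⟩ := exists_hom_eq_id B
    ⟨.pair (.fst B a) (.snd A b), by
      simpa [hom, ha, hb] using pair_eta (𝟙 (Formula.prod A B))⟩
  | .sum A B =>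
    let ⟨a, ha⟩ := exists_hom_eq_id A
    let ⟨b, hb⟩ := exists_hom_eq_id B
    ⟨.copair (.inl B a) (.inr A b), by
      simpa [hom, ha, hb] using copair_eta (𝟙 (Formula.sum A B))⟩

theorem exists_hom_eq_toHom {A B : Formula L} (f : Tm A B) :
    ∃ h : CutFree A B, h.hom = f.toHom := by
  induction f with
  | one A => exact exists_hom_eq_id A
  | l A => exact ⟨.init A, rfl⟩
  | k1 A B =>
    obtain ⟨a, ha⟩ := exists_hom_eq_id A
    exact ⟨.fst B a, by rw [hom, ha]; exact Category.comp_id _⟩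
  | k2 A B =>
    obtain ⟨a, ha⟩ := exists_hom_eq_id B
    exact ⟨.snd A a, by rw [hom, ha]; exact Category.comp_id _⟩
  | l1 A B =>
    obtain ⟨a, ha⟩ := exists_hom_eq_id A
    exact ⟨.inl B a, by rw [hom, ha]; exact Category.id_comp _⟩
  | l2 A B =>
    obtain ⟨a, ha⟩ := exists_hom_eq_id B
    exact ⟨.inr A a, by rw [hom, ha]; exact Category.id_comp _⟩
  | w A =>
    obtain ⟨a, ha⟩ := exists_hom_eq_id A
    exact ⟨.pair a a, by rw [hom, ha, toHom_w]⟩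
  | m A =>
    obtain ⟨a, ha⟩ := exists_hom_eq_id A
    exact ⟨.copair a a, by rw [hom, ha, toHom_m]⟩
  | comp g f ihg ihf =>
    obtain ⟨a, ha⟩ := ihf
    obtain ⟨b, hb⟩ := ihg
    obtain ⟨h, hh⟩ := exists_hom_eq_comp a b
    exact ⟨h, by rw [hh, ha, hb]; rfl⟩
  | prod f g ihf ihg =>
    obtain ⟨a, ha⟩ := ihf
    obtain ⟨b, hb⟩ := ihg
    exact ⟨.pair (.fst _ a) (.snd _ b), by rw [toHom_prod, ← ha, ← hb]; rfl⟩
  | sum f g ihf ihg =>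
    obtain ⟨a, ha⟩ := ihf
    obtain ⟨b, hb⟩ := ihg
    exact ⟨.copair (.inl _ a) (.inr _ b), by rw [toHom_sum, ← ha, ← hb]; rfl⟩

/-- This replaces an arbitrary arrow by a derivation whose last rule can be inspected. -/
theorem hom_surjective {A B : Formula L} (f : A ⟶ B) : ∃ h : CutFree A B, h.hom = f :=
  Quotient.inductionOn f exists_hom_eq_toHom

end CutFree

end CutElimination

/-! ### Coherence: the relation determines the arrow -/

section Coherence

variable {L : Type u} {A B C : Formula L}

/-- The relation of an arrow. -/
def rel (f : A ⟶ B) : SetRel (Fin A.len) (Fin B.len) := (G L).map f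

theorem rel_comp (f : A ⟶ B) (g : B ⟶ C) : rel (f ≫ g) = (rel f).comp (rel g) :=
  (G L).map_comp f g

/-- At the level of relations, products and sums are the same biproduct. So a product has injections
and a sum has projections, although these need not come from arrows. Composing with them strips a
projection or an injection off a relation. -/
theorem relL1_relK1 (a b : ℕ) : (relL1 a b).comp (relK1 a b) = SetRel.id := by
  simp [setRel_ext_iff, SetRel.mem_comp, mem_relL1, mem_relK1]

theorem relL2_relK2 (a b : ℕ) : (relL2 a b).comp (relK2 a b) = SetRel.id := by
  simp [setRel_ext_iff, SetRel.mem_comp, mem_relL2, mem_relK2]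

theorem relL1_relK2 (a b : ℕ) : (relL1 a b).comp (relK2 a b) = ∅ := by
  simp [setRel_ext_iff, SetRel.mem_comp, mem_relL1, mem_relK2, castAdd_ne_natAdd]

theorem relL2_relK1 (a b : ℕ) : (relL2 a b).comp (relK1 a b) = ∅ := by
  simp [setRel_ext_iff, SetRel.mem_comp, mem_relL2, mem_relK1, natAdd_ne_castAdd]

/-- The relation of the first injection into a product. -/
def prodIn₁ (A B : Formula L) : SetRel (Fin A.len) (Fin (Formula.prod A B).len) :=
  relL1 A.len B.len

/-- The relation of the second injection into a product. -/
def prodIn₂ (A B : Formula L) : SetRel (Fin B.len) (Fin (Formula.prod A B).len) :=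
  relL2 A.len B.len

/-- The relation of the first projection from a sum. -/
def sumOut₁ (A B : Formula L) : SetRel (Fin (Formula.sum A B).len) (Fin A.len) :=
  relK1 A.len B.len

/-- The relation of the second projection from a sum. -/
def sumOut₂ (A B : Formula L) : SetRel (Fin (Formula.sum A B).len) (Fin B.len) :=
  relK2 A.len B.len

theorem prodIn₁_comp_rel_fst (f : A ⟶ C) : (prodIn₁ A B).comp (rel (fst A B ≫ f)) = rel f := by
  rw [rel_comp, ← SetRel.comp_assoc]
  exact (congrArg (SetRel.comp · (rel f)) (relL1_relK1 _ _)).trans (SetRel.id_comp _)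

theorem prodIn₂_comp_rel_snd (f : B ⟶ C) : (prodIn₂ A B).comp (rel (snd A B ≫ f)) = rel f := by
  rw [rel_comp, ← SetRel.comp_assoc]
  exact (congrArg (SetRel.comp · (rel f)) (relL2_relK2 _ _)).trans (SetRel.id_comp _)

theorem prodIn₁_comp_rel_snd (f : B ⟶ C) : (prodIn₁ A B).comp (rel (snd A B ≫ f)) = ∅ := by
  rw [rel_comp, ← SetRel.comp_assoc]
  exact (congrArg (SetRel.comp · (rel f)) (relL1_relK2 _ _)).trans (SetRel.empty_comp _)

theorem rel_inl_comp_sumOut₁ (f : C ⟶ A) : (rel (f ≫ inl A B)).comp (sumOut₁ A B) = rel f := by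
  rw [rel_comp, SetRel.comp_assoc]
  exact (congrArg (SetRel.comp (rel f)) (relL1_relK1 _ _)).trans (SetRel.comp_id _)

theorem rel_inr_comp_sumOut₂ (f : C ⟶ B) : (rel (f ≫ inr A B)).comp (sumOut₂ A B) = rel f := by
  rw [rel_comp, SetRel.comp_assoc]
  exact (congrArg (SetRel.comp (rel f)) (relL2_relK2 _ _)).trans (SetRel.comp_id _)

theorem rel_inl_comp_sumOut₂ (f : C ⟶ A) : (rel (f ≫ inl A B)).comp (sumOut₂ A B) = ∅ := by
  rw [rel_comp, SetRel.comp_assoc]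
  exact (congrArg (SetRel.comp (rel f)) (relL1_relK2 _ _)).trans (SetRel.comp_empty _)

theorem rel_inr_comp_sumOut₁ (f : C ⟶ B) : (rel (f ≫ inr A B)).comp (sumOut₁ A B) = ∅ := by
  rw [rel_comp, SetRel.comp_assoc]
  exact (congrArg (SetRel.comp (rel f)) (relL2_relK1 _ _)).trans (SetRel.comp_empty _)

theorem rel_comp_left_congr {f g : A ⟶ B} (h : rel f = rel g) (k : C ⟶ A) :
    rel (k ≫ f) = rel (k ≫ g) := by rw [rel_comp, rel_comp, h]

theorem rel_comp_right_congr {f g : A ⟶ B} (h : rel f = rel g) (k : B ⟶ C) :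
    rel (f ≫ k) = rel (g ≫ k) := by rw [rel_comp, rel_comp, h]

theorem rel_comp_eq_empty_left {f : A ⟶ B} (h : rel f = ∅) (k : C ⟶ A) :
    rel (k ≫ f) = ∅ := by rw [rel_comp, h, SetRel.comp_empty]

theorem rel_comp_eq_empty_right {f : A ⟶ B} (h : rel f = ∅) (k : B ⟶ C) :
    rel (f ≫ k) = ∅ := by rw [rel_comp, h, SetRel.empty_comp]

/-- Every rule passes emptiness to its premises, and an axiom has a nonempty relation, so all
branches end in `init`. The factorizations of the premises then combine. -/
theorem CutFree.exists_factor_zero {A B : Formula L} (f : CutFree A B) (h : rel f.hom = ∅) :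
    ∃ z : A ⟶ Formula.zero, f.hom = z ≫ Sesqui.init B := by
  induction f with
  | ax p =>
    have h0 : ((0 : Fin 1), (0 : Fin 1)) ∈ (SetRel.id : SetRel (Fin 1) (Fin 1)) := rfl
    exact absurd h0 (by change _ ∉ rel (CutFree.ax p).hom; rw [h]; exact id)
  | init A => exact ⟨𝟙 _, (Category.id_comp _).symm⟩
  | fst B f ih =>
    obtain ⟨z, hz⟩ := ih (by rw [← prodIn₁_comp_rel_fst (B := B) f.hom, ← hom, h, SetRel.comp_empty])
    exact ⟨Sesqui.fst _ B ≫ z, by rw [hom, hz, Category.assoc]⟩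
  | snd A f ih =>
    obtain ⟨z, hz⟩ := ih (by rw [← prodIn₂_comp_rel_snd (A := A) f.hom, ← hom, h, SetRel.comp_empty])
    exact ⟨Sesqui.snd A _ ≫ z, by rw [hom, hz, Category.assoc]⟩
  | inl B f ih =>
    obtain ⟨z, hz⟩ := ih (by rw [← rel_inl_comp_sumOut₁ (B := B) f.hom, ← hom, h, SetRel.empty_comp])
    exact ⟨z, by rw [hom, hz, Category.assoc]; exact congrArg _ (zero_hom_ext _ _)⟩
  | inr A f ih =>
    obtain ⟨z, hz⟩ := ih (by rw [← rel_inr_comp_sumOut₂ (A := A) f.hom, ← hom, h, SetRel.empty_comp])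
    exact ⟨z, by rw [hom, hz, Category.assoc]; exact congrArg _ (zero_hom_ext _ _)⟩
  | pair f g ihf ihg =>
    rw [hom] at h
    obtain ⟨z, hz⟩ := ihf (by
      rw [← pair_fst f.hom g.hom]; exact rel_comp_eq_empty_right h _)
    obtain ⟨z', hz'⟩ := ihg (by
      rw [← pair_snd f.hom g.hom]; exact rel_comp_eq_empty_right h _)
    exact ⟨z, by
      -- The two components reach `O` by equal arrows; this is where subterminality of `O` is
      -- needed.
      rw [hom, hz, hz', hom_zero_ext z' z, ← comp_pair]; exact congrArg _ (zero_hom_ext _ _)⟩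
  | copair f g ihf ihg =>
    rw [hom] at h
    obtain ⟨z, hz⟩ := ihf (by
      rw [← inl_copair f.hom g.hom]; exact rel_comp_eq_empty_left h _)
    obtain ⟨z', hz'⟩ := ihg (by
      rw [← inr_copair f.hom g.hom]; exact rel_comp_eq_empty_left h _)
    exact ⟨Sesqui.copair z z', by rw [hom, hz, hz', copair_comp]⟩

/-- An arrow with empty relation factors through the initial object. -/
theorem exists_factor_zero (f : A ⟶ B) (h : rel f = ∅) :
    ∃ z : A ⟶ Formula.zero, f = z ≫ init B := by
  obtain ⟨f, rfl⟩ := CutFree.hom_surjective f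
  exact f.exists_factor_zero h

theorem eq_of_rel_eq_empty {f g : A ⟶ B} (hf : rel f = ∅) (hg : rel g = ∅) : f = g := by
  obtain ⟨z, rfl⟩ := exists_factor_zero f hf
  obtain ⟨z', rfl⟩ := exists_factor_zero g hg
  rw [hom_zero_ext z z']

/-- Left rules pass the hypothesis to their premises until the target is introduced. If that happens
by the second injection, the premise has empty relation, hence goes through `O`, and from `O` the
first injection serves equally well. -/
theorem CutFree.exists_factor_inl : ∀ {A B C : Formula L} (f : CutFree A (.sum B C)),
    (rel f.hom).comp (sumOut₂ B C) = ∅ → ∃ g : A ⟶ B, f.hom = g ≫ Sesqui.inl B C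
  | _, _, _, .init _, _ => ⟨Sesqui.init _, zero_hom_ext _ _⟩
  | _, _, _, .inl _ f, _ => ⟨f.hom, rfl⟩
  | _, B, C, .inr _ f, h => by
    rw [hom, rel_inr_comp_sumOut₂] at h
    obtain ⟨z, hz⟩ := f.exists_factor_zero h
    exact ⟨z ≫ Sesqui.init B, by
      rw [hom, hz, Category.assoc, Category.assoc]; exact congrArg _ (zero_hom_ext _ _)⟩
  | _, _, _, .fst D f, h => by
    obtain ⟨g, hg⟩ := exists_factor_inl f (by
      rw [← prodIn₁_comp_rel_fst (B := D), SetRel.comp_assoc]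
      rw [hom] at h
      rw [h, SetRel.comp_empty])
    exact ⟨Sesqui.fst _ D ≫ g, by rw [hom, hg, Category.assoc]⟩
  | _, _, _, .snd D f, h => by
    obtain ⟨g, hg⟩ := exists_factor_inl f (by
      rw [← prodIn₂_comp_rel_snd (A := D), SetRel.comp_assoc]
      rw [hom] at h
      rw [h, SetRel.comp_empty])
    exact ⟨Sesqui.snd D _ ≫ g, by rw [hom, hg, Category.assoc]⟩
  | _, _, _, .copair f₁ f₂, h => by
    rw [hom] at h
    obtain ⟨g₁, hg₁⟩ := exists_factor_inl f₁ (by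
      rw [← inl_copair f₁.hom f₂.hom, rel_comp, SetRel.comp_assoc, h, SetRel.comp_empty])
    obtain ⟨g₂, hg₂⟩ := exists_factor_inl f₂ (by
      rw [← inr_copair f₁.hom f₂.hom, rel_comp, SetRel.comp_assoc, h, SetRel.comp_empty])
    exact ⟨Sesqui.copair g₁ g₂, by rw [hom, hg₁, hg₂, copair_comp]⟩

theorem CutFree.exists_factor_inr : ∀ {A B C : Formula L} (f : CutFree A (.sum B C)),
    (rel f.hom).comp (sumOut₁ B C) = ∅ → ∃ g : A ⟶ C, f.hom = g ≫ Sesqui.inr B C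
  | _, _, _, .init _, _ => ⟨Sesqui.init _, zero_hom_ext _ _⟩
  | _, _, _, .inr _ f, _ => ⟨f.hom, rfl⟩
  | _, B, C, .inl _ f, h => by
    rw [hom, rel_inl_comp_sumOut₁] at h
    obtain ⟨z, hz⟩ := f.exists_factor_zero h
    exact ⟨z ≫ Sesqui.init C, by
      rw [hom, hz, Category.assoc, Category.assoc]; exact congrArg _ (zero_hom_ext _ _)⟩
  | _, _, _, .fst D f, h => by
    obtain ⟨g, hg⟩ := exists_factor_inr f (by
      rw [← prodIn₁_comp_rel_fst (B := D), SetRel.comp_assoc]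
      rw [hom] at h
      rw [h, SetRel.comp_empty])
    exact ⟨Sesqui.fst _ D ≫ g, by rw [hom, hg, Category.assoc]⟩
  | _, _, _, .snd D f, h => by
    obtain ⟨g, hg⟩ := exists_factor_inr f (by
      rw [← prodIn₂_comp_rel_snd (A := D), SetRel.comp_assoc]
      rw [hom] at h
      rw [h, SetRel.comp_empty])
    exact ⟨Sesqui.snd D _ ≫ g, by rw [hom, hg, Category.assoc]⟩
  | _, _, _, .copair f₁ f₂, h => by
    rw [hom] at h
    obtain ⟨g₁, hg₁⟩ := exists_factor_inr f₁ (by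
      rw [← inl_copair f₁.hom f₂.hom, rel_comp, SetRel.comp_assoc, h, SetRel.comp_empty])
    obtain ⟨g₂, hg₂⟩ := exists_factor_inr f₂ (by
      rw [← inr_copair f₁.hom f₂.hom, rel_comp, SetRel.comp_assoc, h, SetRel.comp_empty])
    exact ⟨Sesqui.copair g₁ g₂, by rw [hom, hg₁, hg₂, copair_comp]⟩

/-- Coherence when one of the arrows into a sum factors through the first injection. -/
theorem comp_inl_eq_of_rel_eq (ih : ∀ f g : A ⟶ B, rel f = rel g → f = g) (f : A ⟶ B)
    (g : A ⟶ Formula.sum B C) (h : rel (f ≫ inl B C) = rel g) : f ≫ inl B C = g := by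
  obtain ⟨g, rfl⟩ := CutFree.hom_surjective g
  -- The relation of `f ≫ inl B C` misses `C`, hence so does that of `g`, and the injection can be
  -- cancelled on both sides.
  obtain ⟨g', hg'⟩ := g.exists_factor_inl (by rw [← h, rel_inl_comp_sumOut₂])
  rw [hg'] at h ⊢
  rw [ih f g' (by rw [← rel_inl_comp_sumOut₁ (B := C) f, h, rel_inl_comp_sumOut₁])]

/-- Coherence when one of the arrows into a sum factors through the second injection. -/
theorem comp_inr_eq_of_rel_eq (ih : ∀ f g : A ⟶ C, rel f = rel g → f = g) (f : A ⟶ C)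
    (g : A ⟶ Formula.sum B C) (h : rel (f ≫ inr B C) = rel g) : f ≫ inr B C = g := by
  obtain ⟨g, rfl⟩ := CutFree.hom_surjective g
  obtain ⟨g', hg'⟩ := g.exists_factor_inr (by rw [← h, rel_inr_comp_sumOut₁])
  rw [hg'] at h ⊢
  rw [ih f g' (by rw [← rel_inr_comp_sumOut₂ (A := B) f, h, rel_inr_comp_sumOut₂])]

theorem fst_comp_eq_of_rel_eq (ih : ∀ f g : A ⟶ C, rel f = rel g → f = g) {f g : A ⟶ C}
    (h : rel (fst A B ≫ f) = rel (fst A B ≫ g)) : fst A B ≫ f = fst A B ≫ g := by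
  rw [ih f g (by rw [← prodIn₁_comp_rel_fst (B := B) f, h, prodIn₁_comp_rel_fst])]

theorem snd_comp_eq_of_rel_eq (ih : ∀ f g : B ⟶ C, rel f = rel g → f = g) {f g : B ⟶ C}
    (h : rel (snd A B ≫ f) = rel (snd A B ≫ g)) : snd A B ≫ f = snd A B ≫ g := by
  rw [ih f g (by rw [← prodIn₂_comp_rel_snd (A := A) f, h, prodIn₂_comp_rel_snd])]

/-- The two relations live on disjoint halves of the source, so if equal they are empty. -/
theorem fst_comp_eq_snd_comp_of_rel_eq {f : A ⟶ C} {g : B ⟶ C}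
    (h : rel (fst A B ≫ f) = rel (snd A B ≫ g)) : fst A B ≫ f = snd A B ≫ g := by
  have hf : rel (fst A B ≫ f) = ∅ := rel_comp_eq_empty_left (by
    rw [← prodIn₁_comp_rel_fst (B := B) f, h, prodIn₁_comp_rel_snd]) _
  exact eq_of_rel_eq_empty hf (h ▸ hf)

/-- Coherence for arrows out of a product into a letter or a sum. -/
theorem prod_hom_eq_of_rel_eq (hA : ∀ f g : A ⟶ C, rel f = rel g → f = g)
    (hB : ∀ f g : B ⟶ C, rel f = rel g → f = g)
    (hC : ∀ C₁ C₂, C = .sum C₁ C₂ → (∀ f g : Formula.prod A B ⟶ C₁, rel f = rel g → f = g) ∧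
      ∀ f g : Formula.prod A B ⟶ C₂, rel f = rel g → f = g)
    (hC' : ∀ C₁ C₂, C ≠ .prod C₁ C₂)
    (f g : Formula.prod A B ⟶ C) (h : rel f = rel g) : f = g := by
  obtain ⟨f, rfl⟩ := CutFree.hom_surjective f
  obtain ⟨g, rfl⟩ := CutFree.hom_surjective g
  cases f with
  | inl _ f => exact comp_inl_eq_of_rel_eq (hC _ _ rfl).1 _ _ h
  | inr _ f => exact comp_inr_eq_of_rel_eq (hC _ _ rfl).2 _ _ h
  | pair f₁ f₂ => exact absurd rfl (hC' _ _)
  | fst _ f =>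
    cases g with
    | inl _ g => exact (comp_inl_eq_of_rel_eq (hC _ _ rfl).1 _ _ h.symm).symm
    | inr _ g => exact (comp_inr_eq_of_rel_eq (hC _ _ rfl).2 _ _ h.symm).symm
    | pair g₁ g₂ => exact absurd rfl (hC' _ _)
    | fst _ g => exact fst_comp_eq_of_rel_eq hA h
    | snd _ g => exact fst_comp_eq_snd_comp_of_rel_eq h
  | snd _ f =>
    cases g with
    | inl _ g => exact (comp_inl_eq_of_rel_eq (hC _ _ rfl).1 _ _ h.symm).symm
    | inr _ g => exact (comp_inr_eq_of_rel_eq (hC _ _ rfl).2 _ _ h.symm).symm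
    | pair g₁ g₂ => exact absurd rfl (hC' _ _)
    | fst _ g => exact (fst_comp_eq_snd_comp_of_rel_eq h.symm).symm
    | snd _ g => exact snd_comp_eq_of_rel_eq hB h

/-- Arrows with the same relation are equal. -/
theorem rel_injective : ∀ (A B : Formula L) (f g : A ⟶ B), rel f = rel g → f = g
  | .zero, _, f, g, _ => zero_hom_ext f g
  | .sum A₁ A₂, B, _, _, h =>
    sum_hom_ext (rel_injective A₁ B _ _ (rel_comp_left_congr h _))
      (rel_injective A₂ B _ _ (rel_comp_left_congr h _))
  | .letter p, .prod B₁ B₂, _, _, h =>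
    prod_hom_ext (rel_injective _ B₁ _ _ (rel_comp_right_congr h _))
      (rel_injective _ B₂ _ _ (rel_comp_right_congr h _))
  | .prod A₁ A₂, .prod B₁ B₂, _, _, h =>
    prod_hom_ext (rel_injective _ B₁ _ _ (rel_comp_right_congr h _))
      (rel_injective _ B₂ _ _ (rel_comp_right_congr h _))
  | .letter _, .zero, f, g, _ => hom_zero_ext f g
  | .prod _ _, .zero, f, g, _ => hom_zero_ext f g
  | .letter p, .letter q, f, g, _ => by
    obtain ⟨f, rfl⟩ := CutFree.hom_surjective f
    obtain ⟨g, rfl⟩ := CutFree.hom_surjective g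
    cases f
    cases g
    rfl
  | .letter p, .sum B₁ B₂, f, g, h => by
    -- No left rule applies to a letter, so the last rule must be an injection.
    obtain ⟨f, rfl⟩ := CutFree.hom_surjective f
    cases f with
    | inl _ f => exact comp_inl_eq_of_rel_eq (rel_injective (.letter p) B₁) _ _ h
    | inr _ f => exact comp_inr_eq_of_rel_eq (rel_injective (.letter p) B₂) _ _ h
  | .prod A₁ A₂, .letter q, f, g, h =>
    prod_hom_eq_of_rel_eq (rel_injective A₁ (.letter q)) (rel_injective A₂ (.letter q))
      (fun _ _ e => nomatch e) (fun _ _ e => nomatch e) f g h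
  | .prod A₁ A₂, .sum B₁ B₂, f, g, h => by
    refine prod_hom_eq_of_rel_eq (rel_injective A₁ (.sum B₁ B₂)) (rel_injective A₂ (.sum B₁ B₂))
      (fun C₁ C₂ e => ?_) (fun _ _ e => nomatch e) f g h
    cases e
    exact ⟨rel_injective (.prod A₁ A₂) B₁, rel_injective (.prod A₁ A₂) B₂⟩
termination_by A B => sizeOf A + sizeOf B

theorem toHom_eq_iff {f g : Tm A B} : f.toHom = g.toHom ↔ f.graph = g.graph :=
  ⟨fun h => congrArg rel h, fun h => rel_injective A B _ _ h⟩

theorem tmEq_of_graph_eq {f g : Tm A B} (h : f.graph = g.graph) : TmEq f g :=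
  Quotient.exact (toHom_eq_iff.2 h)

end Coherence

/-! ### Course-of-values recursion is primitive recursive -/

section CourseOfValues

variable {σ : Type}

/-- The list of the first `n` values of the function defined by course-of-values recursion. -/
def history (s : List σ → σ) (n : ℕ) : List σ := n.rec [] fun _ l => l ++ [s l]

/-- Course-of-values recursion: the value at `n` is computed from the list of earlier values. -/
def courseOfValues (s : List σ → σ) (n : ℕ) : σ := s (history s n)

theorem history_succ (s : List σ → σ) (n : ℕ) :
    history s (n + 1) = history s n ++ [courseOfValues s n] := rfl

theorem history_eq_map (s : List σ → σ) (n : ℕ) :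
    history s n = (List.range n).map (courseOfValues s) := by
  induction n with
  | zero => rfl
  | succ n ih => rw [history_succ, ih, List.range_succ, List.map_append]; rfl

theorem length_history (s : List σ → σ) (n : ℕ) : (history s n).length = n := by
  simp [history_eq_map]

theorem getI_history [Inhabited σ] (s : List σ → σ) {m n : ℕ} (h : m < n) :
    (history s n).getI m = courseOfValues s m := by
  rw [List.getI_eq_getElem _ (by rwa [length_history])]
  simp [history_eq_map]

/-- The table of earlier values is itself built by ordinary primitive recursion, one entry at a
time. -/
theorem primrec_courseOfValues [Primcodable σ] {s : List σ → σ} (hs : Primrec s) :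
    Primrec (courseOfValues s) :=
  hs.comp (Primrec.nat_rec₁ [] (Primrec.list_concat.comp Primrec.snd (hs.comp Primrec.snd)).to₂)

end CourseOfValues

/-! ### Codes of parts are smaller than codes of compounds -/

section Pairing

/-- Positivity matters: `Nat.pair 0 0 = 0`. Tag `0` marks only letters and identities, where no
earlier value is needed. -/
theorem lt_pair_of_pos {t a : ℕ} (ht : 0 < t) : a < Nat.pair t a := by
  unfold Nat.pair
  split_ifs with h
  · nlinarith
  · omega

theorem left_lt_pair_pair {t : ℕ} (ht : 0 < t) (a b : ℕ) : a < Nat.pair t (Nat.pair a b) :=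
  (Nat.left_le_pair a b).trans_lt (lt_pair_of_pos ht)

theorem right_lt_pair_pair {t : ℕ} (ht : 0 < t) (a b : ℕ) : b < Nat.pair t (Nat.pair a b) :=
  (Nat.right_le_pair a b).trans_lt (lt_pair_of_pos ht)

end Pairing

/-! ### Computing the length of a formula from its code -/

section FormulaLength

/-- The recursion step for computing the length of a formula from its Gödel number. -/
def lenStep (h : List ℕ) : ℕ :=
  if h.length.unpair.1 = 0 then 1 else if h.length.unpair.1 = 1 then 0 else
    h.getI h.length.unpair.2.unpair.1 + h.getI h.length.unpair.2.unpair.2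

/-- The length of the formula with a given Gödel number. -/
def lenOfCode : ℕ → ℕ := courseOfValues lenStep

theorem primrec_lenOfCode : Primrec lenOfCode := by
  refine primrec_courseOfValues ?_
  have hn : Primrec fun h : List ℕ => h.length.unpair := Primrec.unpair.comp Primrec.list_length
  have ht := Primrec.fst.comp hn
  have hp := Primrec.unpair.comp (Primrec.snd.comp hn)
  exact .ite (Primrec.eq.comp ht (.const 0)) (.const 1) <|
    .ite (Primrec.eq.comp ht (.const 1)) (.const 0) <|
      Primrec.nat_add.comp (Primrec.list_getI.comp .id (Primrec.fst.comp hp))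
        (Primrec.list_getI.comp .id (Primrec.snd.comp hp))

variable {L : Type u}

theorem lenOfCode_code (c : L → ℕ) (A : Formula L) : lenOfCode (A.code c) = A.len := by
  induction A with
  | letter p => simp [lenOfCode, courseOfValues, lenStep, length_history, Formula.code, Formula.len]
  | zero => simp [lenOfCode, courseOfValues, lenStep, length_history, Formula.code, Formula.len]
  | prod A B ihA ihB =>
    rw [Formula.len, ← ihA, ← ihB, lenOfCode]
    -- Only the value at the compound is unfolded, so that the values at its parts still match
    -- `getI_history`.
    nth_rewrite 1 [courseOfValues]
    simp [lenStep, length_history, Formula.code, getI_history, left_lt_pair_pair,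
      right_lt_pair_pair]
  | sum A B ihA ihB =>
    rw [Formula.len, ← ihA, ← ihB, lenOfCode]
    nth_rewrite 1 [courseOfValues]
    simp [lenStep, length_history, Formula.code, getI_history, left_lt_pair_pair,
      right_lt_pair_pair]

end FormulaLength

/-! ### Finite relations as lists of pairs -/

section FiniteRelations

/-- The list of pairs `(x, x)` with `x < n`. -/
def diagList (n : ℕ) : List (ℕ × ℕ) := (List.range n).map fun x => (x, x)

/-- Translation of a list of pairs. -/
def shiftList (a b : ℕ) (l : List (ℕ × ℕ)) : List (ℕ × ℕ) := l.map fun p => (p.1 + a, p.2 + b)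

/-- Composition of relations given by lists of pairs. -/
def compList (l r : List (ℕ × ℕ)) : List (ℕ × ℕ) :=
  l.flatMap fun p => r.filterMap fun q => if p.2 = q.1 then some (p.1, q.2) else none

theorem primrec_diagList : Primrec diagList :=
  Primrec.list_map Primrec.list_range (Primrec.pair Primrec.snd Primrec.snd).to₂

theorem primrec_shiftList {α : Type} [Primcodable α] {a b : α → ℕ} {l : α → List (ℕ × ℕ)}
    (ha : Primrec a) (hb : Primrec b) (hl : Primrec l) :
    Primrec fun x => shiftList (a x) (b x) (l x) :=
  Primrec.list_map hl <| Primrec.pair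
    (Primrec.nat_add.comp (Primrec.fst.comp Primrec.snd) (ha.comp Primrec.fst))
    (Primrec.nat_add.comp (Primrec.snd.comp Primrec.snd) (hb.comp Primrec.fst))

theorem primrec_compList : Primrec₂ compList := by
  refine Primrec.list_flatMap Primrec.fst (Primrec.listFilterMap (Primrec.snd.comp Primrec.fst) ?_)
  have hp : Primrec fun x : ((List (ℕ × ℕ) × List (ℕ × ℕ)) × (ℕ × ℕ)) × (ℕ × ℕ) => x.1.2 :=
    Primrec.snd.comp Primrec.fst
  have hq : Primrec fun x : ((List (ℕ × ℕ) × List (ℕ × ℕ)) × (ℕ × ℕ)) × (ℕ × ℕ) => x.2 :=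
    Primrec.snd
  exact .ite (Primrec.eq.comp (Primrec.snd.comp hp) (Primrec.fst.comp hq))
    (Primrec.option_some.comp (.pair (Primrec.fst.comp hp) (Primrec.snd.comp hq))) (.const none)

theorem mem_diagList {n i j : ℕ} : (i, j) ∈ diagList n ↔ i < n ∧ i = j := by
  simp [diagList]
  grind

theorem mem_shiftList {a b i j : ℕ} {l : List (ℕ × ℕ)} :
    (i, j) ∈ shiftList a b l ↔ ∃ x y, (x, y) ∈ l ∧ x + a = i ∧ y + b = j := by
  simp [shiftList]

theorem mem_compList {i k : ℕ} {l r : List (ℕ × ℕ)} :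
    (i, k) ∈ compList l r ↔ ∃ j, (i, j) ∈ l ∧ (j, k) ∈ r := by
  simp only [compList, List.mem_flatMap, List.mem_filterMap, Prod.exists]
  grind

/-- The list `l` enumerates the relation `R`. -/
def Enumerates {a b : ℕ} (l : List (ℕ × ℕ)) (R : SetRel (Fin a) (Fin b)) : Prop :=
  ∀ i j, (i, j) ∈ l ↔ ∃ x y, (x, y) ∈ R ∧ x.val = i ∧ y.val = j

variable {a b c d : ℕ} {l r : List (ℕ × ℕ)}

theorem Enumerates.mem_iff {R : SetRel (Fin a) (Fin b)} (h : Enumerates l R) (x : Fin a)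
    (y : Fin b) : (x.val, y.val) ∈ l ↔ (x, y) ∈ R := by
  rw [h]
  constructor
  · rintro ⟨x', y', h, hx, hy⟩
    rwa [← Fin.ext hx, ← Fin.ext hy]
  · exact fun h => ⟨x, y, h, rfl, rfl⟩

/-- Enumerations may differ in order and repetitions, so the lists are compared by mutual inclusion.
-/
theorem Enumerates.eq_iff {R S : SetRel (Fin a) (Fin b)} (hl : Enumerates l R)
    (hr : Enumerates r S) : R = S ↔ (∀ p ∈ l, p ∈ r) ∧ ∀ p ∈ r, p ∈ l := by
  constructor
  · rintro rfl
    exact ⟨fun p hp => (hr p.1 p.2).2 ((hl p.1 p.2).1 hp),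
      fun p hp => (hl p.1 p.2).2 ((hr p.1 p.2).1 hp)⟩
  · rintro ⟨h₁, h₂⟩
    refine setRel_ext_iff.2 fun x y => ?_
    rw [← hl.mem_iff, ← hr.mem_iff]
    exact ⟨h₁ _, h₂ _⟩

theorem enumerates_empty : Enumerates [] (∅ : SetRel (Fin a) (Fin b)) := by
  simp [Enumerates]

theorem enumerates_id : Enumerates (diagList a) (SetRel.id (α := Fin a)) := by
  intro i j
  simp only [mem_diagList, SetRel.mem_id]
  exact ⟨fun ⟨h, e⟩ => ⟨⟨i, h⟩, ⟨i, h⟩, rfl, rfl, e⟩, by rintro ⟨x, _, rfl, rfl, rfl⟩; exact ⟨x.2, rfl⟩⟩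

theorem enumerates_relK1 : Enumerates (diagList a) (relK1 a b) := by
  intro i j
  simp only [mem_diagList, mem_relK1]
  exact ⟨fun ⟨h, e⟩ => ⟨_, ⟨i, h⟩, rfl, rfl, e⟩, by rintro ⟨_, y, rfl, rfl, rfl⟩; exact ⟨y.2, rfl⟩⟩

theorem enumerates_relL1 : Enumerates (diagList a) (relL1 a b) := by
  intro i j
  simp only [mem_diagList, mem_relL1]
  exact ⟨fun ⟨h, e⟩ => ⟨⟨i, h⟩, _, rfl, rfl, e⟩, by rintro ⟨x, _, rfl, rfl, rfl⟩; exact ⟨x.2, rfl⟩⟩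

theorem enumerates_relK2 : Enumerates (shiftList a 0 (diagList b)) (relK2 a b) := by
  intro i j
  simp only [mem_shiftList, mem_diagList, mem_relK2]
  constructor
  · rintro ⟨x, _, ⟨h, rfl⟩, rfl, rfl⟩
    exact ⟨_, ⟨x, h⟩, rfl, Nat.add_comm _ _, rfl⟩
  · rintro ⟨_, y, rfl, rfl, rfl⟩
    exact ⟨y, y, ⟨y.2, rfl⟩, Nat.add_comm _ _, rfl⟩

theorem enumerates_relL2 : Enumerates (shiftList 0 a (diagList b)) (relL2 a b) := by
  intro i j
  simp only [mem_shiftList, mem_diagList, mem_relL2]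
  constructor
  · rintro ⟨x, _, ⟨h, rfl⟩, rfl, rfl⟩
    exact ⟨⟨x, h⟩, _, rfl, rfl, Nat.add_comm _ _⟩
  · rintro ⟨y, _, rfl, rfl, rfl⟩
    exact ⟨y, y, ⟨y.2, rfl⟩, rfl, Nat.add_comm _ _⟩

theorem Enumerates.union {R S : SetRel (Fin a) (Fin b)} (hl : Enumerates l R)
    (hr : Enumerates r S) : Enumerates (l ++ r) (R ∪ S) := by
  intro i j
  rw [List.mem_append, hl, hr]
  simp only [Set.mem_union]
  grind

/-- The codiagonal relation is by definition the union of the two projection relations. -/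
theorem enumerates_relM :
    Enumerates (diagList a ++ shiftList a 0 (diagList a)) (relM a) :=
  enumerates_relK1.union enumerates_relK2

theorem enumerates_relW :
    Enumerates (diagList a ++ shiftList 0 a (diagList a)) (relW a) :=
  enumerates_relL1.union enumerates_relL2

theorem Enumerates.comp {R : SetRel (Fin a) (Fin b)} {S : SetRel (Fin b) (Fin c)}
    (hl : Enumerates l R) (hr : Enumerates r S) : Enumerates (compList l r) (R.comp S) := by
  intro i k
  rw [mem_compList]
  constructor
  · rintro ⟨j, hj, hk⟩
    obtain ⟨x, y, h, rfl, rfl⟩ := (hl _ _).1 hj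
    obtain ⟨y', z, h', e, rfl⟩ := (hr _ _).1 hk
    obtain rfl := Fin.ext e
    exact ⟨x, z, ⟨_, h, h'⟩, rfl, rfl⟩
  · rintro ⟨x, z, ⟨y, h, h'⟩, rfl, rfl⟩
    exact ⟨y, (hl.mem_iff _ _).2 h, (hr.mem_iff _ _).2 h'⟩

theorem Enumerates.juxtapose {R : SetRel (Fin a) (Fin b)} {S : SetRel (Fin c) (Fin d)}
    (hl : Enumerates l R) (hr : Enumerates r S) :
    Enumerates (l ++ shiftList a b r) (juxtapose R S) := by
  intro i j
  rw [List.mem_append, mem_shiftList]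
  constructor
  · rintro (h | ⟨_, _, h, rfl, rfl⟩)
    · obtain ⟨x, y, hxy, rfl, rfl⟩ := (hl _ _).1 h
      exact ⟨_, _, Or.inl ⟨x, y, hxy, rfl⟩, rfl, rfl⟩
    · obtain ⟨x, y, hxy, rfl, rfl⟩ := (hr _ _).1 h
      exact ⟨_, _, Or.inr ⟨x, y, hxy, rfl⟩, Nat.add_comm _ _, Nat.add_comm _ _⟩
  · rintro ⟨_, _, ⟨x, y, h, e⟩ | ⟨x, y, h, e⟩, rfl, rfl⟩ <;> cases e
    · exact Or.inl ((hl.mem_iff _ _).2 h)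
    · exact Or.inr ⟨x, y, (hr.mem_iff _ _).2 h, Nat.add_comm _ _, Nat.add_comm _ _⟩

end FiniteRelations

/-! ### Computing the relation of a term and deciding equality -/

section TermGraph

/-- The recursion step for computing, from the Gödel number of a term, the lengths of its source
and target and a list enumerating its relation.  Here `t` is the tag, `n` the length of the single formula in
the code, `a` and `b` are the lengths of a pair of formulae and `u` and `v` the values of a pair of
subterms in the code. -/
def graphCases (t n a b : ℕ) (u v : (ℕ × ℕ) × List (ℕ × ℕ)) : (ℕ × ℕ) × List (ℕ × ℕ) :=
  if t = 0 then ((n, n), diagList n) else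
  if t = 1 then ((0, n), []) else
  if t = 2 then ((a + b, a), diagList a) else
  if t = 3 then ((a + b, b), shiftList a 0 (diagList b)) else
  if t = 4 then ((a, a + b), diagList a) else
  if t = 5 then ((b, a + b), shiftList 0 a (diagList b)) else
  if t = 6 then ((n, n + n), diagList n ++ shiftList 0 n (diagList n)) else
  if t = 7 then ((n + n, n), diagList n ++ shiftList n 0 (diagList n)) else
  -- The code of `g ∘ f` stores `g` first, so `v` belongs to the arrow applied first.
  if t = 8 then ((v.1.1, u.1.2), compList v.2 u.2) else
  -- Products and sums of terms have the same relation. The shift by the lengths of the first factor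
  -- is why lengths are carried along. Numbers with any larger tag also land here, harmlessly.
  ((u.1.1 + v.1.1, u.1.2 + v.1.2), u.2 ++ shiftList u.1.1 u.1.2 v.2)

theorem primrec_graphCases {α : Type} [Primcodable α] {t n a b : α → ℕ}
    {u v : α → (ℕ × ℕ) × List (ℕ × ℕ)} (ht : Primrec t) (hn : Primrec n) (ha : Primrec a)
    (hb : Primrec b) (hu : Primrec u) (hv : Primrec v) :
    Primrec fun x => graphCases (t x) (n x) (a x) (b x) (u x) (v x) := by
  have eq (k : ℕ) : PrimrecPred fun x => t x = k := Primrec.eq.comp ht (.const k)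
  have hz : Primrec fun _ : α => 0 := .const 0
  have hdn := primrec_diagList.comp hn
  have hda := primrec_diagList.comp ha
  have hdb := primrec_diagList.comp hb
  have hab := Primrec.nat_add.comp ha hb
  have hnn := Primrec.nat_add.comp hn hn
  have hu₁ := Primrec.fst.comp (Primrec.fst.comp hu)
  have hu₂ := Primrec.snd.comp (Primrec.fst.comp hu)
  have hv₁ := Primrec.fst.comp (Primrec.fst.comp hv)
  have hv₂ := Primrec.snd.comp (Primrec.fst.comp hv)
  have hug := Primrec.snd.comp hu
  have hvg := Primrec.snd.comp hv
  exact .ite (eq 0) (.pair (.pair hn hn) hdn) <|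
    .ite (eq 1) (.pair (.pair hz hn) (.const [])) <|
    .ite (eq 2) (.pair (.pair hab ha) hda) <|
    .ite (eq 3) (.pair (.pair hab hb) (primrec_shiftList ha hz hdb)) <|
    .ite (eq 4) (.pair (.pair ha hab) hda) <|
    .ite (eq 5) (.pair (.pair hb hab) (primrec_shiftList hz ha hdb)) <|
    .ite (eq 6) (.pair (.pair hn hnn)
      (Primrec.list_append.comp hdn (primrec_shiftList hz hn hdn))) <|
    .ite (eq 7) (.pair (.pair hnn hn)
      (Primrec.list_append.comp hdn (primrec_shiftList hn hz hdn))) <|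
    .ite (eq 8) (.pair (.pair hv₁ hu₂) (primrec_compList.comp hvg hug)) <|
    .pair (.pair (Primrec.nat_add.comp hu₁ hv₁) (Primrec.nat_add.comp hu₂ hv₂))
      (Primrec.list_append.comp hug (primrec_shiftList hu₁ hu₂ hvg))

/-- `graphCases` applied to the Gödel number `h.length` and the list `h` of earlier values. -/
def graphStep (h : List ((ℕ × ℕ) × List (ℕ × ℕ))) : (ℕ × ℕ) × List (ℕ × ℕ) :=
  graphCases h.length.unpair.1 (lenOfCode h.length.unpair.2)
    (lenOfCode h.length.unpair.2.unpair.1) (lenOfCode h.length.unpair.2.unpair.2)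
    (h.getI h.length.unpair.2.unpair.1) (h.getI h.length.unpair.2.unpair.2)

/-- The source length, target length and relation of the term with a given Gödel number. -/
def graphOfCode : ℕ → (ℕ × ℕ) × List (ℕ × ℕ) := courseOfValues graphStep

theorem primrec_graphOfCode : Primrec graphOfCode := by
  refine primrec_courseOfValues ?_
  have hn : Primrec fun h : List ((ℕ × ℕ) × List (ℕ × ℕ)) => h.length.unpair :=
    Primrec.unpair.comp Primrec.list_length
  have hp := Primrec.unpair.comp (Primrec.snd.comp hn)
  exact primrec_graphCases (Primrec.fst.comp hn) (primrec_lenOfCode.comp (Primrec.snd.comp hn))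
    (primrec_lenOfCode.comp (Primrec.fst.comp hp)) (primrec_lenOfCode.comp (Primrec.snd.comp hp))
    (Primrec.list_getI.comp .id (Primrec.fst.comp hp))
    (Primrec.list_getI.comp .id (Primrec.snd.comp hp))

/-- Meant for atomic terms with a single formula index: the remaining arguments come from reading
that formula's code as a pair, and are left unspecified because those cases ignore them. -/
theorem graphOfCode_pair (t n : ℕ) : ∃ a b u v, graphOfCode (Nat.pair t n) =
    graphCases t (lenOfCode n) a b u v := by
  rw [graphOfCode, courseOfValues, graphStep, length_history, Nat.unpair_pair]
  exact ⟨_, _, _, _, rfl⟩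

theorem graphOfCode_pair_pair {t : ℕ} (ht : 0 < t) (m n : ℕ) :
    graphOfCode (Nat.pair t (Nat.pair m n)) =
      graphCases t (lenOfCode (Nat.pair m n)) (lenOfCode m) (lenOfCode n) (graphOfCode m)
        (graphOfCode n) := by
  rw [graphOfCode]
  nth_rewrite 1 [courseOfValues]
  simp [graphStep, length_history, getI_history, left_lt_pair_pair ht, right_lt_pair_pair ht]

variable {L : Type u}

/-- A letter contributes length `1` whatever its number, so `c` need not be injective. -/
theorem graphOfCode_code (c : L → ℕ) {A B : Formula L} (f : Tm A B) :
    (graphOfCode (f.code c)).1 = (A.len, B.len) ∧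
      Enumerates (graphOfCode (f.code c)).2 f.graph := by
  induction f with
  | one A =>
    obtain ⟨_, _, _, _, h⟩ := graphOfCode_pair 0 (A.code c)
    rw [Tm.code, h, lenOfCode_code]
    exact ⟨rfl, enumerates_id⟩
  | l A =>
    obtain ⟨_, _, _, _, h⟩ := graphOfCode_pair 1 (A.code c)
    rw [Tm.code, h, lenOfCode_code]
    exact ⟨rfl, enumerates_empty⟩
  | k1 A B =>
    rw [Tm.code, graphOfCode_pair_pair (by decide), lenOfCode_code, lenOfCode_code]
    exact ⟨rfl, enumerates_relK1⟩
  | k2 A B =>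
    rw [Tm.code, graphOfCode_pair_pair (by decide), lenOfCode_code, lenOfCode_code]
    exact ⟨rfl, enumerates_relK2⟩
  | l1 A B =>
    rw [Tm.code, graphOfCode_pair_pair (by decide), lenOfCode_code, lenOfCode_code]
    exact ⟨rfl, enumerates_relL1⟩
  | l2 A B =>
    rw [Tm.code, graphOfCode_pair_pair (by decide), lenOfCode_code, lenOfCode_code]
    exact ⟨rfl, enumerates_relL2⟩
  | w A =>
    obtain ⟨_, _, _, _, h⟩ := graphOfCode_pair 6 (A.code c)
    rw [Tm.code, h, lenOfCode_code]
    exact ⟨rfl, enumerates_relW⟩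
  | m A =>
    obtain ⟨_, _, _, _, h⟩ := graphOfCode_pair 7 (A.code c)
    rw [Tm.code, h, lenOfCode_code]
    exact ⟨rfl, enumerates_relM⟩
  | comp g f ihg ihf =>
    rw [Tm.code, graphOfCode_pair_pair (by decide)]
    have h := ihf.2.comp ihg.2
    simp only [graphCases, ihf.1, ihg.1]
    exact ⟨rfl, h⟩
  | prod f g ihf ihg =>
    rw [Tm.code, graphOfCode_pair_pair (by decide)]
    have h := ihf.2.juxtapose ihg.2
    simp only [graphCases, ihf.1, ihg.1]
    exact ⟨rfl, h⟩
  | sum f g ihf ihg =>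
    rw [Tm.code, graphOfCode_pair_pair (by decide)]
    have h := ihf.2.juxtapose ihg.2
    simp only [graphCases, ihf.1, ihg.1]
    exact ⟨rfl, h⟩

/-- The decision procedure: compare the relations of two terms given by Gödel numbers. -/
def decideEq (m n : ℕ) : Bool :=
  decide ((∀ p ∈ (graphOfCode m).2, p ∈ (graphOfCode n).2) ∧
    ∀ p ∈ (graphOfCode n).2, p ∈ (graphOfCode m).2)

theorem primrecRel_list_subset :
    PrimrecRel fun l r : List (ℕ × ℕ) => ∀ p ∈ l, p ∈ r := by
  have hmem : PrimrecRel fun (p : ℕ × ℕ) (l : List (ℕ × ℕ)) => p ∈ l :=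
    ((Primrec.eq (α := ℕ × ℕ)).exists_mem_list.comp₂ Primrec₂.right Primrec₂.left).of_eq
      (by simp)
  exact hmem.forall_mem_list

theorem computable_decideEq : Computable₂ decideEq := by
  have h : Primrec fun x : ℕ × ℕ => (graphOfCode x.1).2 :=
    Primrec.snd.comp (primrec_graphOfCode.comp Primrec.fst)
  have h' : Primrec fun x : ℕ × ℕ => (graphOfCode x.2).2 :=
    Primrec.snd.comp (primrec_graphOfCode.comp Primrec.snd)
  exact ((primrecRel_list_subset.comp h h').and
    (primrecRel_list_subset.comp h' h)).decide.to_comp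

theorem decideEq_code (c : L → ℕ) {A B : Formula L} (f g : Tm A B) :
    decideEq (f.code c) (g.code c) = true ↔ f.toHom = g.toHom := by
  rw [toHom_eq_iff, decideEq, decide_eq_true_iff,
    (graphOfCode_code c f).2.eq_iff (graphOfCode_code c g).2]

end TermGraph

end Sesqui

theorem mainTheorem1 (L : Type u) :
    -- coherence: parallel terms with the same relation are equal
    (∀ (A B : Sesqui.Formula L) (f g : Sesqui.Tm A B),
      f.graph = g.graph → Sesqui.TmEq f g) ∧
    -- the functor to relations on finite ordinals is faithful
    (Sesqui.G L).Faithful ∧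
    -- an algorithm decides, from the Gödel numbers of two parallel terms, whether they are
    -- equal in the free sesquicartesian category
    (∃ d : ℕ → ℕ → Bool, Computable₂ d ∧
      ∀ (c : L → ℕ) (A B : Sesqui.Formula L) (f g : Sesqui.Tm A B),
        d (f.code c) (g.code c) = true ↔ f.toHom = g.toHom) :=
  ⟨fun _ _ _ _ => Sesqui.tmEq_of_graph_eq, ⟨fun h => Sesqui.rel_injective _ _ _ _ h⟩,
    Sesqui.decideEq, Sesqui.computable_decideEq, fun c _ _ => Sesqui.decideEq_code c⟩
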